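/- Let $\Omega$ be a Polish space with its Borel $\sigma$-algebra, and let $d:\Omega\times\Omega\to[0,\infty)$ be a metric on $\Omega$ that is lower semicontinuous with respect to the product topology (it need not induce the topology of $\Omega$). For probability measures $\mu,\nu$ on $\Omega$ let $W_d(\mu,\nu)=\inf_{\xi}\int d(x,y)\,\xi(\mathrm dx,\mathrm dy)\in[0,\infty]$, where $\xi$ ranges over all couplings of $\mu$ and $\nu$, i.e. all probability measures on $\Omega\times\Omega$ with marginals $\mu$ and $\nu$. Let $Q,K$ be Markov transition kernels on $\Omega$. Assume that $\alpha>0$ and $0\le\varepsilon<\infty$ are real numbers such that $$W_d(Q(x,\cdot),Q(y,\cdot))\le(1-\alpha)\,d(x,y)\quad\text{for all }x,y\in\Omega,\qquad W_d(Q(x,\cdot),K(x,\cdot))\le\varepsilon\quad\text{for all }x\in\Omega.$$ Then, for all probability measures $p_0,\widetilde p_0$ on $\Omega$ and every integer $n\ge0$, $$W_d(p_0Q^n,\widetilde p_0K^n)\le(1-\alpha)^nW_d(p_0,\widetilde p_0)+\varepsilon\,\min\{n,\alpha^{-1}\},$$ where $p_0Q^n$ is the law after $n$ steps of a Markov chain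 with transition kernel $Q$ and initial law $p_0$ (similarly for $\widetilde p_0K^n$), with the convention $0\cdot\infty=0$. Moreover, if $\pi_Q$ and $\pi_K$ are stationary distributions of $Q$ and $K$, respectively (that is, probability measures with $\pi_QQ=\pi_Q$ and $\pi_KK=\pi_K$), and $W_d(\pi_Q,\pi_K)<\infty$, then $$W_d(\pi_Q,\pi_K)\le\frac{\varepsilon}{\alpha}.$$ -/

import Mathlib

open MeasureTheory ProbabilityTheory
open scoped ENNReal NNReal

/-- `d : Ω × Ω → [0, ∞)` is a metric on the topological space `Ω` that is lower semicontinuous for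
the product topology. The metric need not induce the topology of `Ω`. -/
structure IsLscMetric {Ω : Type*} [TopologicalSpace Ω] (d : Ω → Ω → ℝ≥0) : Prop where
  eq_zero_iff : ∀ x y, d x y = 0 ↔ x = y
  symm : ∀ x y, d x y = d y x
  triangle : ∀ x y z, d x z ≤ d x y + d y z
  lowerSemicontinuous : LowerSemicontinuous fun p : Ω × Ω => d p.1 p.2

/-- The set of couplings of `μ` and `ν`: the probability measures on `Ω × Ω` with first marginal `μ`
and second marginal `ν`. -/
def couplings {Ω : Type*} [MeasurableSpace Ω] (μ ν : Measure Ω) : Set (Measure (Ω × Ω)) :=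
  {ξ | IsProbabilityMeasure ξ ∧ ξ.map Prod.fst = μ ∧ ξ.map Prod.snd = ν}

/-- The Wasserstein distance `W_d(μ, ν)`, the infimum of the expectation of `d(X, Y)` over all
couplings of `μ` and `ν`, with values in `[0, ∞]`. -/
noncomputable def wasserstein {Ω : Type*} [MeasurableSpace Ω] (d : Ω → Ω → ℝ≥0)
    (μ ν : Measure Ω) : ℝ≥0∞ :=
  ⨅ ξ ∈ couplings μ ν, ∫⁻ p, (d p.1 p.2 : ℝ≥0∞) ∂ξ

open Filter Topology

/-! ### Couplings and gluing. -/

section Couplings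

variable {Ω : Type*} [MeasurableSpace Ω] {d : Ω → Ω → ℝ≥0}

/-! Passing through `Q y`, `wasserstein_triangle` bounds the cost between `Q x` and `K y` by `(1 -
α) d(x, y) + ε`. Integrating over a coupling of the initial laws gives the one-step bound
`wasserstein_bind_bind_le`. Iterating it yields a geometric sum, at most `min n α⁻¹`; for stationary
laws at finite distance, let `n → ∞`.

The hard point is the integration, `wasserstein_bind_le`, which seems to need a measurable choice of
near-optimal couplings. Instead the kernels are approximated by ones factoring through `ℕ`, where
any choice is measurable, and the limit is taken with `wasserstein_le_liminf`, which rests on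
Prokhorov's theorem. -/

lemma prod_mem_couplings (μ ν : Measure Ω) [IsProbabilityMeasure μ] [IsProbabilityMeasure ν] :
    μ.prod ν ∈ couplings μ ν :=
  ⟨inferInstance, by simp [← Measure.fst.eq_1], by simp [← Measure.snd.eq_1]⟩

lemma wasserstein_le_lintegral {μ ν : Measure Ω} {ξ : Measure (Ω × Ω)} (h : ξ ∈ couplings μ ν) :
    wasserstein d μ ν ≤ ∫⁻ p, (d p.1 p.2 : ℝ≥0∞) ∂ξ :=
  iInf₂_le ξ h

lemma exists_coupling_lintegral_lt {μ ν : Measure Ω} {b : ℝ≥0∞} (h : wasserstein d μ ν < b) :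
    ∃ ξ ∈ couplings μ ν, ∫⁻ p, (d p.1 p.2 : ℝ≥0∞) ∂ξ < b := by
  simpa [wasserstein, iInf_lt_iff] using h

lemma wasserstein_eq_zero_of_subsingleton [Subsingleton Ω] (hd : ∀ x, d x x = 0)
    (μ ν : Measure Ω) [IsProbabilityMeasure μ] [IsProbabilityMeasure ν] :
    wasserstein d μ ν = 0 := by
  refine le_antisymm ((wasserstein_le_lintegral (prod_mem_couplings μ ν)).trans ?_) zero_le
  have : ∀ p : Ω × Ω, d p.1 p.2 = 0 := fun p => by rw [Subsingleton.elim p.2 p.1, hd]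
  simp [this]

/-- The triangle inequality for the transport cost, by gluing couplings along the common
marginal. -/
lemma wasserstein_triangle [StandardBorelSpace Ω] (hd : Measurable fun p : Ω × Ω => d p.1 p.2)
    (htri : ∀ x y z, d x z ≤ d x y + d y z) (μ ν ρ : Measure Ω) [IsProbabilityMeasure ν] :
    wasserstein d μ ρ ≤ wasserstein d μ ν + wasserstein d ν ρ := by
  have hne : Nonempty Ω := nonempty_of_isProbabilityMeasure ν
  refine ENNReal.le_of_forall_pos_le_add fun δ hδ hfin => ?_
  have hδ' : (δ / 2 : ℝ≥0∞) ≠ 0 := by simpa using hδ.ne'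
  obtain ⟨h1, h2⟩ := ENNReal.add_lt_top.1 hfin
  obtain ⟨ξ₁, ⟨hp₁, hf₁, hs₁⟩, hc₁⟩ :=
    exists_coupling_lintegral_lt (ENNReal.lt_add_right h1.ne hδ')
  obtain ⟨ξ₂, ⟨hp₂, hf₂, hs₂⟩, hc₂⟩ :=
    exists_coupling_lintegral_lt (ENNReal.lt_add_right h2.ne hδ')
  have hd' : Measurable fun p : Ω × Ω => (d p.1 p.2 : ℝ≥0∞) := hd.coe_nnreal_ennreal
  -- After the swap both couplings have first marginal `ν` and can be disintegrated over it; `ζ`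
  -- makes the outer points conditionally independent given the middle one, which is its first
  -- coordinate.
  set η := ξ₁.map Prod.swap with hη
  have : IsProbabilityMeasure η := Measure.isProbabilityMeasure_map measurable_swap.aemeasurable
  have hηf : η.fst = ν := by
    rw [Measure.fst, hη, Measure.map_map measurable_fst measurable_swap]; exact hs₁
  have hξ₂f : ξ₂.fst = ν := hf₂
  set ζ := ν ⊗ₘ (η.condKernel ×ₖ ξ₂.condKernel) with hζ
  have hζ₁ : ζ.map (Prod.map id Prod.fst) = η := by
    rw [hζ, ← Measure.compProd_map measurable_fst, ← Kernel.fst_eq, Kernel.fst_prod, ← hηf,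
      η.disintegrate]
  have hζ₂ : ζ.map (Prod.map id Prod.snd) = ξ₂ := by
    rw [hζ, ← Measure.compProd_map measurable_snd, ← Kernel.snd_eq, Kernel.snd_prod, ← hξ₂f,
      ξ₂.disintegrate]
  have hζ₁' : ζ.map (fun t => (t.2.1, t.1)) = ξ₁ := by
    have : ξ₁ = η.map Prod.swap := by
      rw [hη, Measure.map_map measurable_swap measurable_swap]; simp
    rw [this, ← hζ₁, Measure.map_map measurable_swap (by fun_prop)]
    rfl
  have hζc : ζ.map Prod.snd ∈ couplings μ ρ := by
    refine ⟨Measure.isProbabilityMeasure_map measurable_snd.aemeasurable, ?_, ?_⟩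
    · rw [Measure.map_map measurable_fst measurable_snd, ← hf₁, ← hζ₁',
        Measure.map_map measurable_fst (by fun_prop)]
      rfl
    · rw [Measure.map_map measurable_snd measurable_snd, ← hs₂, ← hζ₂,
        Measure.map_map measurable_snd (by fun_prop)]
      rfl
  calc wasserstein d μ ρ ≤ ∫⁻ p, (d p.1 p.2 : ℝ≥0∞) ∂(ζ.map Prod.snd) :=
        wasserstein_le_lintegral hζc
    _ = ∫⁻ t, (d t.2.1 t.2.2 : ℝ≥0∞) ∂ζ := lintegral_map hd' measurable_snd
    _ ≤ ∫⁻ t, ((d t.2.1 t.1 : ℝ≥0∞) + d t.1 t.2.2) ∂ζ :=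
        lintegral_mono fun t => by
          rw [← ENNReal.coe_add]; exact ENNReal.coe_le_coe.2 (htri t.2.1 t.1 t.2.2)
    _ = ∫⁻ t, (d t.2.1 t.1 : ℝ≥0∞) ∂ζ + ∫⁻ t, (d t.1 t.2.2 : ℝ≥0∞) ∂ζ :=
        lintegral_add_left (hd'.comp (g := fun p => (d p.1 p.2 : ℝ≥0∞))
          (f := fun t : Ω × Ω × Ω => (t.2.1, t.1)) (by fun_prop)) _
    _ = ∫⁻ p, (d p.1 p.2 : ℝ≥0∞) ∂ξ₁ + ∫⁻ p, (d p.1 p.2 : ℝ≥0∞) ∂ξ₂ := by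
        rw [← hζ₁', ← hζ₂, lintegral_map hd' (by fun_prop), lintegral_map hd' (by fun_prop)]
        rfl
    _ ≤ (wasserstein d μ ν + δ / 2) + (wasserstein d ν ρ + δ / 2) := add_le_add hc₁.le hc₂.le
    _ = wasserstein d μ ν + wasserstein d ν ρ + δ := by
        rw [add_add_add_comm, ENNReal.add_halves]

end Couplings

/-! ### Lower semicontinuity under weak convergence. -/

/-- Layer cake: superlevel sets of `f` are open, so `h_opens` applies at each level, and Fatou
handles the integral over levels. -/
lemma lintegral_le_liminf_of_lowerSemicontinuous {X : Type*} [TopologicalSpace X]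
    [MeasurableSpace X] [OpensMeasurableSpace X] {μ : Measure X} {μs : ℕ → Measure X}
    {f : X → ℝ≥0} (hf : LowerSemicontinuous f)
    (h_opens : ∀ G, IsOpen G → μ G ≤ atTop.liminf fun i => μs i G) :
    ∫⁻ x, (f x : ℝ≥0∞) ∂μ ≤ atTop.liminf fun i => ∫⁻ x, (f x : ℝ≥0∞) ∂(μs i) := by
  have key (m : Measure X) :
      ∫⁻ x, (f x : ℝ≥0∞) ∂m = ∫⁻ t in Set.Ioi (0 : ℝ), m {a | t < f a} := by
    rw [← lintegral_eq_lintegral_meas_lt m (Eventually.of_forall fun x => (f x).coe_nonneg)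
      (hf.measurable.coe_nnreal_real).aemeasurable]
    simp
  simp_rw [key]
  refine (setLIntegral_mono' measurableSet_Ioi fun t ht => h_opens {a | t < (f a : ℝ)} ?_).trans
    (lintegral_liminf_le fun n => Antitone.measurable fun s t hst =>
      measure_mono fun ω hω => lt_of_le_of_lt hst hω)
  lift t to ℝ≥0 using (le_of_lt ht)
  simpa [Set.preimage] using hf.isOpen_preimage t

/-- A convergent sequence together with its limit is compact, so the converse half of Prokhorov's
theorem applies. -/
lemma isTightMeasureSet_range_of_tendsto {X : Type*} [TopologicalSpace X] [PolishSpace X]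
    [MeasurableSpace X] [BorelSpace X] {μs : ℕ → ProbabilityMeasure X} {μ : ProbabilityMeasure X}
    (h : Tendsto μs atTop (𝓝 μ)) :
    IsTightMeasureSet (Set.range fun n => (μs n : Measure X)) := by
  let := TopologicalSpace.upgradeIsCompletelyMetrizable X
  have hc : IsCompact (closure (Set.range μs)) :=
    h.isCompact_insert_range.closure_of_subset (Set.subset_insert _ _)
  refine (isTightMeasureSet_of_isCompact_closure hc).subset ?_
  rintro _ ⟨n, rfl⟩
  exact ⟨μs n, ⟨n, rfl⟩, rfl⟩

/-- The transport cost for a lower semicontinuous cost is sequentially lower semicontinuous under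
weak convergence. -/
lemma wasserstein_le_liminf {Ω : Type*} [TopologicalSpace Ω] [PolishSpace Ω]
    [MeasurableSpace Ω] [BorelSpace Ω] {d : Ω → Ω → ℝ≥0}
    (hd : LowerSemicontinuous fun p : Ω × Ω => d p.1 p.2)
    {μs νs : ℕ → ProbabilityMeasure Ω} {μ ν : ProbabilityMeasure Ω}
    (hμ : Tendsto μs atTop (𝓝 μ)) (hν : Tendsto νs atTop (𝓝 ν))
    {b : ℕ → ℝ≥0∞} {B : ℝ≥0∞} (hb : Tendsto b atTop (𝓝 B))
    (h : ∀ n, wasserstein d (μs n : Measure Ω) (νs n : Measure Ω) < b n) :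
    wasserstein d (μ : Measure Ω) (ν : Measure Ω) ≤ B := by
  choose ξ hξ hξb using fun n => exists_coupling_lintegral_lt (h n)
  let Ξ : ℕ → ProbabilityMeasure (Ω × Ω) := fun n => ⟨ξ n, (hξ n).1⟩
  -- Tight marginals force the couplings to be tight, so a subsequence of them converges.
  have htight : IsTightMeasureSet {((m : ProbabilityMeasure (Ω × Ω)) : Measure (Ω × Ω)) |
      m ∈ Set.range Ξ} := by
    refine IsTightMeasureSet.prodMk ((isTightMeasureSet_range_of_tendsto hμ).subset ?_)
      ((isTightMeasureSet_range_of_tendsto hν).subset ?_)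
    · rintro _ ⟨_, ⟨_, ⟨n, rfl⟩, rfl⟩, rfl⟩
      exact ⟨n, (hξ n).2.1.symm⟩
    · rintro _ ⟨_, ⟨_, ⟨n, rfl⟩, rfl⟩, rfl⟩
      exact ⟨n, (hξ n).2.2.symm⟩
  obtain ⟨Ξ', -, φ, hφ, hlim⟩ := (isCompact_closure_of_isTightMeasureSet htight).tendsto_subseq
    fun n => subset_closure (Set.mem_range_self n)
  have hfst : Ξ'.map measurable_fst.aemeasurable = μ := by
    refine tendsto_nhds_unique
      (ProbabilityMeasure.tendsto_map_of_tendsto_of_continuous _ _ hlim continuous_fst)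
      ((hμ.comp hφ.tendsto_atTop).congr fun n => ?_)
    exact Subtype.ext (hξ (φ n)).2.1.symm
  have hsnd : Ξ'.map measurable_snd.aemeasurable = ν := by
    refine tendsto_nhds_unique
      (ProbabilityMeasure.tendsto_map_of_tendsto_of_continuous _ _ hlim continuous_snd)
      ((hν.comp hφ.tendsto_atTop).congr fun n => ?_)
    exact Subtype.ext (hξ (φ n)).2.2.symm
  refine (wasserstein_le_lintegral (ξ := (Ξ' : Measure (Ω × Ω)))
    ⟨inferInstance, congrArg Subtype.val hfst, congrArg Subtype.val hsnd⟩).trans ?_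
  refine (lintegral_le_liminf_of_lowerSemicontinuous hd fun G hG =>
    ProbabilityMeasure.le_liminf_measure_open_of_tendsto hlim hG).trans ?_
  exact (liminf_le_liminf (Eventually.of_forall fun n => (hξb (φ n)).le)).trans_eq
    (hb.comp hφ.tendsto_atTop).liminf_eq

/-! ### Convexity of the cost without measurable selection. -/

/-- A measurable map into a separable pseudometric space is uniformly approximated by maps that
factor through countably many of its values. -/
lemma exists_measurable_nat_dist_lt {Z X : Type*} [Nonempty Z] [MeasurableSpace Z]
    [PseudoMetricSpace X] [SecondCountableTopology X] [MeasurableSpace X] [OpensMeasurableSpace X]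
    {h : Z → X} (hh : Measurable h) {δ : ℝ} (hδ : 0 < δ) :
    ∃ (k : Z → ℕ) (u : ℕ → Z), Measurable k ∧ ∀ z, dist (h (u (k z))) (h z) < δ := by
  classical
  have : Nonempty (Set.range h) := Set.range_nonempty h |>.to_subtype
  choose u hu using fun n => (TopologicalSpace.denseSeq (Set.range h) n).2
  have hex : ∀ z, ∃ n, dist (h (u n)) (h z) < δ := fun z => by
    obtain ⟨n, hn⟩ := (TopologicalSpace.denseRange_denseSeq (Set.range h)).exists_dist_lt
      ⟨h z, z, rfl⟩ hδ
    refine ⟨n, ?_⟩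
    rw [hu, dist_comm]
    exact hn
  -- Taking the least admissible index makes the choice measurable.
  refine ⟨fun z => Nat.find (hex z), u, measurable_find hex fun n => ?_,
    fun z => Nat.find_spec (hex z)⟩
  exact measurableSet_lt (measurable_const.dist hh) measurable_const

lemma measurableSet_of_mem_generateSetAlgebra_countableBasis {Ω : Type*} [TopologicalSpace Ω]
    [SecondCountableTopology Ω] [MeasurableSpace Ω] [OpensMeasurableSpace Ω] {s : Set Ω}
    (hs : s ∈ generateSetAlgebra (TopologicalSpace.countableBasis Ω)) : MeasurableSet s := by
  induction hs with
  | base s hs => exact (TopologicalSpace.isOpen_of_mem_countableBasis hs).measurableSet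
  | empty => exact .empty
  | compl s _ hs => exact hs.compl
  | union s t _ _ hs ht => exact hs.union ht

/-- Kernels that converge pointwise on an algebra of sets containing a basis have mixtures that
converge weakly. -/
lemma tendsto_bind_of_tendsto_apply {Z Ω : Type*} [MeasurableSpace Z] [TopologicalSpace Ω]
    [SecondCountableTopology Ω] [MeasurableSpace Ω] [OpensMeasurableSpace Ω]
    (ξ : Measure Z) [IsProbabilityMeasure ξ] (A : Kernel Z Ω) [IsMarkovKernel A]
    (As : ℕ → Kernel Z Ω) [∀ n, IsMarkovKernel (As n)]
    (h : ∀ s ∈ generateSetAlgebra (TopologicalSpace.countableBasis Ω), ∀ z,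
      Tendsto (fun n => (As n z).real s) atTop (𝓝 ((A z).real s))) :
    Tendsto (β := ProbabilityMeasure Ω) (fun n => ⟨ξ.bind (As n), inferInstance⟩) atTop
      (𝓝 (⟨ξ.bind A, inferInstance⟩ : ProbabilityMeasure Ω)) := by
  have hmeas := fun s => measurableSet_of_mem_generateSetAlgebra_countableBasis (Ω := Ω) (s := s)
  refine IsPiSystem.tendsto_probabilityMeasure_of_tendsto_of_mem
    (S := generateSetAlgebra (TopologicalSpace.countableBasis Ω))
    (fun s hs t ht _ => isSetAlgebra_generateSetAlgebra.inter_mem hs ht) hmeas ?_ ?_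
  · intro u hu x hx
    obtain ⟨s, hs, hxs, hsu⟩ :=
      (TopologicalSpace.isBasis_countableBasis Ω).exists_subset_of_mem_open hx hu
    exact ⟨s, self_subset_generateSetAlgebra hs,
      (TopologicalSpace.isOpen_of_mem_countableBasis hs).mem_nhds hxs, hsu⟩
  · intro s hs
    suffices Tendsto (fun n => ξ.bind (As n) s) atTop (𝓝 (ξ.bind A s)) from
      (ENNReal.tendsto_toNNReal_iff (measure_ne_top (ξ.bind A) s)
        fun n => measure_ne_top (ξ.bind (As n)) s).2 this
    simp_rw [Measure.bind_apply (hmeas s hs) (Kernel.aemeasurable _)]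
    refine tendsto_lintegral_of_dominated_convergence (μ := ξ) (fun _ => 1)
      (fun n => (As n).measurable_coe (hmeas s hs)) (fun n => ae_of_all _ fun z => prob_le_one)
      (by simp) (ae_of_all _ fun z => ?_)
    exact (ENNReal.tendsto_toReal_iff (fun n => measure_ne_top _ _)
      (measure_ne_top _ _)).1 (h s hs z)

/-- Convexity of the transport cost along mixtures, with a measurable upper bound `c` in place of
the cost of the components. -/
lemma wasserstein_bind_le {Ω Z : Type*} [TopologicalSpace Ω] [PolishSpace Ω] [MeasurableSpace Ω]
    [BorelSpace Ω] [MeasurableSpace Z] {d : Ω → Ω → ℝ≥0}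
    (hd : LowerSemicontinuous fun p : Ω × Ω => d p.1 p.2)
    (ξ : Measure Z) [IsProbabilityMeasure ξ] (A B : Kernel Z Ω) [IsMarkovKernel A]
    [IsMarkovKernel B] {c : Z → ℝ≥0} (hc : Measurable c)
    (h : ∀ z, wasserstein d (A z) (B z) ≤ c z) :
    wasserstein d (ξ.bind A) (ξ.bind B) ≤ ∫⁻ z, c z ∂ξ := by
  classical
  have : Nonempty Z := nonempty_of_isProbabilityMeasure ξ
  set S := generateSetAlgebra (TopologicalSpace.countableBasis Ω)
  have hS : S.Countable :=
    countable_generateSetAlgebra (TopologicalSpace.countable_countableBasis Ω)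
  have : Countable S := hS.to_subtype
  have hSmeas : ∀ s ∈ S, MeasurableSet s := fun s =>
    measurableSet_of_mem_generateSetAlgebra_countableBasis
  -- Only the countable products need a chosen metric. The factor `ℝ≥0` keeps its own, so closeness
  -- of `H` bounds `c` uniformly while giving convergence of the kernels on `S`.
  let := TopologicalSpace.pseudoMetrizableSpacePseudoMetric ((S → ℝ) × (S → ℝ))
  let H : Z → ((S → ℝ) × (S → ℝ)) × ℝ≥0 :=
    fun z => ((fun s => (A z).real s, fun s => (B z).real s), c z)
  have hH : Measurable H := by
    refine ((measurable_pi_lambda _ fun s => ?_).prodMk (measurable_pi_lambda _ fun s => ?_)).prodMk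
      hc
    · exact (A.measurable_coe (hSmeas s s.2)).ennreal_toReal
    · exact (B.measurable_coe (hSmeas s s.2)).ennreal_toReal
  choose k u hk hku using fun n : ℕ =>
    exists_measurable_nat_dist_lt hH (Nat.one_div_pos_of_nat (α := ℝ) (n := n))
  let φ : ℕ → Z → Z := fun n z => u n (k n z)
  have hφ : ∀ n, Measurable (φ n) := fun n => (measurable_of_countable (u n)).comp (hk n)
  have hlim : ∀ z, Tendsto (fun n => H (φ n z)) atTop (𝓝 (H z)) := fun z =>
    tendsto_iff_dist_tendsto_zero.2 <| squeeze_zero (fun _ => dist_nonneg)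
      (fun n => (hku n z).le) tendsto_one_div_add_atTop_nhds_zero_nat
  have hcφ : ∀ n z, (c (φ n z) : ℝ≥0∞) ≤ c z + ENNReal.ofReal (1 / ((n : ℝ) + 1)) := by
    intro n z
    have h1 : dist (c (φ n z)) (c z) < 1 / ((n : ℝ) + 1) := (le_max_right _ _).trans_lt (hku n z)
    rw [← ENNReal.ofReal_coe_nnreal, ← ENNReal.ofReal_coe_nnreal,
      ← ENNReal.ofReal_add (c z).coe_nonneg (by positivity)]
    refine ENNReal.ofReal_le_ofReal ?_
    rw [NNReal.dist_eq] at h1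
    linarith [le_abs_self ((c (φ n z) : ℝ) - c z)]
  let δ : ℕ → ℝ≥0∞ := fun n => ENNReal.ofReal (1 / ((n : ℝ) + 1))
  have hδpos : ∀ n, 0 < δ n := fun n => ENNReal.ofReal_pos.2 Nat.one_div_pos_of_nat
  have hδ : Tendsto δ atTop (𝓝 0) := by
    simpa [δ] using ENNReal.tendsto_ofReal (tendsto_one_div_add_atTop_nhds_zero_nat (𝕜 := ℝ))
  let As : ℕ → Kernel Z Ω := fun n => A.comap (φ n) (hφ n)
  let Bs : ℕ → Kernel Z Ω := fun n => B.comap (φ n) (hφ n)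
  have hA := tendsto_bind_of_tendsto_apply ξ A As fun s hs z =>
    (tendsto_pi_nhds.1 ((hlim z).fst_nhds.fst_nhds)) ⟨s, hs⟩
  have hB := tendsto_bind_of_tendsto_apply ξ B Bs fun s hs z =>
    (tendsto_pi_nhds.1 ((hlim z).fst_nhds.snd_nhds)) ⟨s, hs⟩
  rcases eq_or_ne (∫⁻ z, c z ∂ξ) ⊤ with htop | htop
  · simp [htop]
  -- One `δ n` pays for moving `c`, one for near-optimality of the couplings, one for the strict
  -- inequality.
  have hlimb : Tendsto (fun n => ∫⁻ z, c z ∂ξ + (δ n + δ n + δ n)) atTop (𝓝 (∫⁻ z, c z ∂ξ)) := by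
    simpa using (tendsto_const_nhds (x := ∫⁻ z, c z ∂ξ)).add ((hδ.add hδ).add hδ)
  refine wasserstein_le_liminf hd hA hB hlimb fun n => ?_
  -- Couplings are chosen only at the countably many points `u n i`, so `κ` is a kernel with no
  -- selection theorem.
  choose η hη hηc using fun i => exists_coupling_lintegral_lt
    ((h (u n i)).trans_lt (ENNReal.lt_add_right ENNReal.coe_ne_top (hδpos n).ne'))
  have hηp : ∀ i, IsProbabilityMeasure (η i) := fun i => (hη i).1
  let κ : Kernel Z (Ω × Ω) := (Kernel.ofFunOfCountable η).comap (k n) (hk n)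
  have hκ : IsMarkovKernel κ := ⟨fun z => hηp (k n z)⟩
  have hcoup : ξ.bind κ ∈ couplings (ξ.bind (As n)) (ξ.bind (Bs n)) := by
    refine ⟨inferInstance, ?_, ?_⟩
    · rw [Measure.map_comp _ _ measurable_fst]
      congr 2
      ext1 z
      rw [Kernel.map_apply _ measurable_fst]
      exact (hη (k n z)).2.1
    · rw [Measure.map_comp _ _ measurable_snd]
      congr 2
      ext1 z
      rw [Kernel.map_apply _ measurable_snd]
      exact (hη (k n z)).2.2
  calc wasserstein d (ξ.bind (As n)) (ξ.bind (Bs n))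
      ≤ ∫⁻ p, (d p.1 p.2 : ℝ≥0∞) ∂(ξ.bind κ) := wasserstein_le_lintegral hcoup
    _ = ∫⁻ z, ∫⁻ p, (d p.1 p.2 : ℝ≥0∞) ∂(κ z) ∂ξ :=
        Measure.lintegral_bind (Kernel.aemeasurable _) hd.measurable.coe_nnreal_ennreal.aemeasurable
    _ ≤ ∫⁻ z, (c z + (δ n + δ n)) ∂ξ := lintegral_mono fun z =>
        (hηc (k n z)).le.trans <| by
          rw [← add_assoc]
          exact add_le_add_left (hcφ n z) _
    _ = ∫⁻ z, c z ∂ξ + (δ n + δ n) := by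
        rw [lintegral_add_right _ measurable_const]; simp
    _ < ∫⁻ z, c z ∂ξ + (δ n + δ n + δ n) := by
        rw [← add_assoc, ← add_assoc, ← add_assoc]
        refine ENNReal.lt_add_right ?_ (hδpos n).ne'
        simp [htop, δ]

/-! ### Kernel powers and the contraction rate. -/

section Pow

variable {Z : Type*} [MeasurableSpace Z]

lemma isMarkovKernel_pow (P : Kernel Z Z) [IsMarkovKernel P] (n : ℕ) : IsMarkovKernel (P ^ n) := by
  induction n with
  | zero => exact inferInstanceAs (IsMarkovKernel Kernel.id)
  | succ n ih => rw [pow_succ']; exact inferInstanceAs (IsMarkovKernel (P ∘ₖ (P ^ n)))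

lemma bind_pow_zero (P : Kernel Z Z) (ρ : Measure Z) : ρ.bind (P ^ 0 : Kernel Z Z) = ρ := by
  rw [pow_zero]
  exact Measure.id_comp

lemma bind_pow_succ (P : Kernel Z Z) (ρ : Measure Z) (n : ℕ) :
    ρ.bind (P ^ (n + 1) : Kernel Z Z) = (ρ.bind (P ^ n : Kernel Z Z)).bind P := by
  rw [pow_succ', Measure.comp_assoc]
  rfl

lemma bind_pow_of_invariant {P : Kernel Z Z} {ρ : Measure Z} (h : P.Invariant ρ) (n : ℕ) :
    ρ.bind (P ^ n : Kernel Z Z) = ρ := by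
  induction n with
  | zero => exact bind_pow_zero P ρ
  | succ n ih => rw [bind_pow_succ, ih, h.def]

end Pow

lemma subsingleton_of_contraction_of_one_lt {Ω : Type*} [TopologicalSpace Ω]
    [MeasurableSpace Ω] {d : Ω → Ω → ℝ≥0} (hd : IsLscMetric d) {Q : Kernel Ω Ω} {α : ℝ}
    (hα : 1 < α) (hcontr : ∀ x y,
      (wasserstein d (Q x) (Q y) : EReal) ≤ (((1 - α) * (d x y : ℝ) : ℝ) : EReal)) :
    Subsingleton Ω := by
  refine ⟨fun x y => (hd.eq_zero_iff x y).1 ?_⟩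
  have h0 : (0 : EReal) ≤ (((1 - α) * (d x y : ℝ) : ℝ) : EReal) :=
    (EReal.coe_ennreal_nonneg _).trans (hcontr x y)
  have h1 : 0 ≤ (1 - α) * (d x y : ℝ) := by exact_mod_cast h0
  have h2 : (d x y : ℝ) ≤ 0 := by
    by_contra! h
    nlinarith
  exact le_antisymm (by exact_mod_cast h2) zero_le

lemma geom_sum_le_min {r α : ℝ} (hr : 0 ≤ r) (hα : 0 < α) (hrα : r = 1 - α) (n : ℕ) :
    ∑ j ∈ Finset.range n, r ^ j ≤ min (n : ℝ) α⁻¹ := by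
  refine le_min ?_ ?_
  · calc _ ≤ ∑ j ∈ Finset.range n, (1 : ℝ) :=
          Finset.sum_le_sum fun j _ => pow_le_one₀ hr (by linarith)
      _ = n := by simp
  · have h := mul_neg_geom_sum r n
    rw [show 1 - r = α by linarith] at h
    rw [← one_div, le_div_iff₀' hα, h]
    linarith [pow_nonneg hr n]

/-! ### One-step bound and its iteration. -/

section Perturbation

variable {Ω : Type*} [TopologicalSpace Ω] [PolishSpace Ω] [MeasurableSpace Ω] [BorelSpace Ω]
  {d : Ω → Ω → ℝ≥0}

lemma wasserstein_bind_bind_le (hd : LowerSemicontinuous fun p : Ω × Ω => d p.1 p.2)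
    {A B : Kernel Ω Ω} [IsMarkovKernel A] [IsMarkovKernel B] {r e : ℝ≥0}
    (h : ∀ x y, wasserstein d (A x) (B y) ≤ r * d x y + e)
    (μ ν : Measure Ω) [IsProbabilityMeasure μ] [IsProbabilityMeasure ν] :
    wasserstein d (μ.bind A) (ν.bind B) ≤ r * wasserstein d μ ν + e := by
  have key : ∀ ξ ∈ couplings μ ν, wasserstein d (μ.bind A) (ν.bind B) ≤
      r * ∫⁻ p, (d p.1 p.2 : ℝ≥0∞) ∂ξ + e := by
    rintro ξ ⟨hξ, h1, h2⟩
    let A' : Kernel (Ω × Ω) Ω := A.comap Prod.fst measurable_fst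
    let B' : Kernel (Ω × Ω) Ω := B.comap Prod.snd measurable_snd
    have hA : ξ.bind A' = μ.bind A := by
      rw [← h1, Measure.bind, Measure.bind, Measure.map_map A.measurable measurable_fst]
      rfl
    have hB : ξ.bind B' = ν.bind B := by
      rw [← h2, Measure.bind, Measure.bind, Measure.map_map B.measurable measurable_snd]
      rfl
    have := wasserstein_bind_le hd ξ A' B' (c := fun p => r * d p.1 p.2 + e)
      ((hd.measurable.const_mul r).add_const e) fun p =>
        (h p.1 p.2).trans_eq (by push_cast; rfl)
    rw [hA, hB] at this
    refine this.trans_eq ?_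
    simp only [ENNReal.coe_add, ENNReal.coe_mul]
    rw [lintegral_add_right _ measurable_const,
      lintegral_const_mul _ hd.measurable.coe_nnreal_ennreal]
    simp
  -- For `r = 0` the cost of the coupling is irrelevant, even if infinite; otherwise a finite
  -- right-hand side forces a finite `wasserstein d μ ν`.
  rcases eq_or_ne r 0 with rfl | hr
  · simpa using key _ (prod_mem_couplings μ ν)
  · refine ENNReal.le_of_forall_pos_le_add fun δ hδ hfin => ?_
    have hW : wasserstein d μ ν ≠ ⊤ := by
      intro hW
      simp [hW, ENNReal.mul_top, hr] at hfin
    have hδr : (δ / r : ℝ≥0) ≠ 0 := (div_pos hδ (pos_iff_ne_zero.2 hr)).ne'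
    obtain ⟨ξ, hξ, hlt⟩ := exists_coupling_lintegral_lt
      (ENNReal.lt_add_right hW (ENNReal.coe_ne_zero.2 hδr))
    calc _ ≤ _ := key ξ hξ
      _ ≤ r * (wasserstein d μ ν + (δ / r : ℝ≥0)) + e := by gcongr
      _ = r * wasserstein d μ ν + e + δ := by
        rw [mul_add, ← ENNReal.coe_mul, mul_div_cancel₀ _ hr, add_right_comm]

lemma wasserstein_bind_pow_le (hd : IsLscMetric d) {Q K : Kernel Ω Ω} [IsMarkovKernel Q]
    [IsMarkovKernel K] {r e : ℝ≥0} (hQ : ∀ x y, wasserstein d (Q x) (Q y) ≤ r * d x y)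
    (hK : ∀ x, wasserstein d (Q x) (K x) ≤ e)
    (μ ν : Measure Ω) [IsProbabilityMeasure μ] [IsProbabilityMeasure ν] (n : ℕ) :
    wasserstein d (μ.bind (Q ^ n : Kernel Ω Ω)) (ν.bind (K ^ n : Kernel Ω Ω)) ≤
      (r ^ n : ℝ≥0) * wasserstein d μ ν + (e * ∑ j ∈ Finset.range n, r ^ j : ℝ≥0) := by
  have hstep : ∀ x y, wasserstein d (Q x) (K y) ≤ r * d x y + e := fun x y =>
    (wasserstein_triangle hd.lowerSemicontinuous.measurable hd.triangle _ (Q y) _).trans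
      (add_le_add (hQ x y) (hK y))
  induction n with
  | zero =>
    rw [bind_pow_zero, bind_pow_zero]
    simp
  | succ n ih =>
    have := isMarkovKernel_pow Q n
    have := isMarkovKernel_pow K n
    rw [bind_pow_succ, bind_pow_succ]
    refine (wasserstein_bind_bind_le hd.lowerSemicontinuous hstep _ _).trans ?_
    calc _ ≤ r * ((r ^ n : ℝ≥0) * wasserstein d μ ν +
          (e * ∑ j ∈ Finset.range n, r ^ j : ℝ≥0)) + e := by gcongr
      _ = _ := by
        rw [Finset.sum_range_succ', mul_add, ← mul_assoc, add_assoc]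
        norm_cast
        congr 2
        · congr 1; ring
        · rw [mul_add, mul_left_comm, Finset.mul_sum]
          simp only [pow_succ', pow_zero, mul_one]

end Perturbation

/-! ### The perturbation theorem. -/

theorem theorem1 {Ω : Type*} [TopologicalSpace Ω] [PolishSpace Ω] [MeasurableSpace Ω]
    [BorelSpace Ω] (d : Ω → Ω → ℝ≥0) (hd : IsLscMetric d)
    (Q K : Kernel Ω Ω) [IsMarkovKernel Q] [IsMarkovKernel K]
    (α : ℝ) (hα : 0 < α)
    (hcontr : ∀ x y, (wasserstein d (Q x) (Q y) : EReal) ≤ (((1 - α) * (d x y : ℝ) : ℝ) : EReal))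
    (ε : ℝ) (hε : 0 ≤ ε)
    (happrox : ∀ x, (wasserstein d (Q x) (K x) : EReal) ≤ (ε : EReal)) :
    (∀ (p₀ p₀' : Measure Ω) [IsProbabilityMeasure p₀] [IsProbabilityMeasure p₀'] (n : ℕ),
      (wasserstein d (p₀.bind (Q ^ n : Kernel Ω Ω)) (p₀'.bind (K ^ n : Kernel Ω Ω)) : EReal) ≤
        (((1 - α) ^ n : ℝ) : EReal) * (wasserstein d p₀ p₀' : EReal) +
          ((ε * min (n : ℝ) α⁻¹ : ℝ) : EReal)) ∧
    (∀ (πQ πK : Measure Ω) [IsProbabilityMeasure πQ] [IsProbabilityMeasure πK],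
      Q.Invariant πQ → K.Invariant πK → wasserstein d πQ πK < ⊤ →
        (wasserstein d πQ πK : EReal) ≤ ((ε / α : ℝ) : EReal)) := by
  have hdiag : ∀ x, d x x = 0 := fun x => (hd.eq_zero_iff x x).2 rfl
  -- If `α > 1`, nonnegativity of the cost forces `d = 0`, so `Ω` is a single point; otherwise `1 -
  -- α` is a nonnegative rate `r`.
  rcases lt_or_ge 1 α with h | h
  · have := subsingleton_of_contraction_of_one_lt hd h hcontr
    refine ⟨fun p₀ p₀' _ _ n => ?_, fun πQ πK _ _ _ _ _ => ?_⟩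
    · have := isMarkovKernel_pow Q n
      have := isMarkovKernel_pow K n
      rw [wasserstein_eq_zero_of_subsingleton hdiag, wasserstein_eq_zero_of_subsingleton hdiag]
      simp only [EReal.coe_ennreal_zero, mul_zero, zero_add]
      exact_mod_cast (by positivity : 0 ≤ ε * min (n : ℝ) α⁻¹)
    · rw [wasserstein_eq_zero_of_subsingleton hdiag]
      exact EReal.coe_nonneg.2 (div_nonneg hε hα.le)
  have hcoe : ∀ x : ℝ≥0, ((x : ℝ) : EReal) = ((x : ℝ≥0∞) : EReal) := fun _ => rfl
  lift ε to ℝ≥0 using hε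
  obtain ⟨r, hr⟩ : ∃ r : ℝ≥0, (r : ℝ) = 1 - α := ⟨⟨1 - α, by linarith⟩, rfl⟩
  have hQ : ∀ x y, wasserstein d (Q x) (Q y) ≤ r * d x y := fun x y => by
    have := hcontr x y
    rw [← hr, ← NNReal.coe_mul, hcoe, EReal.coe_ennreal_le_coe_ennreal_iff] at this
    exact_mod_cast this
  have hK : ∀ x, wasserstein d (Q x) (K x) ≤ ε := fun x =>
    EReal.coe_ennreal_le_coe_ennreal_iff.1 (happrox x)
  have main (p₀ p₀' : Measure Ω) [IsProbabilityMeasure p₀] [IsProbabilityMeasure p₀'] (n : ℕ) :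
      (wasserstein d (p₀.bind (Q ^ n : Kernel Ω Ω)) (p₀'.bind (K ^ n : Kernel Ω Ω)) : EReal) ≤
        (((1 - α) ^ n : ℝ) : EReal) * (wasserstein d p₀ p₀' : EReal) +
          ((ε * min (n : ℝ) α⁻¹ : ℝ) : EReal) := by
    have h := EReal.coe_ennreal_le_coe_ennreal_iff.2 (wasserstein_bind_pow_le hd hQ hK p₀ p₀' n)
    rw [EReal.coe_ennreal_add, EReal.coe_ennreal_mul, ← hcoe, ← hcoe, NNReal.coe_pow, hr] at h
    refine h.trans (add_le_add_right (EReal.coe_le_coe_iff.2 ?_) _)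
    push_cast
    exact mul_le_mul_of_nonneg_left (geom_sum_le_min r.coe_nonneg hα hr n) ε.coe_nonneg
  refine ⟨main, fun πQ πK _ _ hπQ hπK hfin => ?_⟩
  have hn := main πQ πK
  -- By invariance the left side no longer depends on `n`, and finiteness of the distance makes the
  -- `(1 - α) ^ n` term vanish in the limit.
  simp only [bind_pow_of_invariant hπQ, bind_pow_of_invariant hπK] at hn
  lift wasserstein d πQ πK to ℝ≥0 using hfin.ne with w
  have hlim : Tendsto (fun n : ℕ => (1 - α) ^ n * (w : ℝ) + ε / α) atTop (𝓝 (0 * w + ε / α)) :=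
    ((tendsto_pow_atTop_nhds_zero_of_lt_one (by linarith) (by linarith)).mul_const _).add_const _
  rw [zero_mul, zero_add] at hlim
  rw [← hcoe, EReal.coe_le_coe_iff]
  refine ge_of_tendsto' hlim fun n => ?_
  have h := hn n
  rw [← hcoe, ← EReal.coe_mul, ← EReal.coe_add, EReal.coe_le_coe_iff] at h
  refine h.trans ?_
  rw [div_eq_mul_inv]
  gcongr
  exact min_le_right _ _
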